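/- A topological dynamical system $(X,d,T)$ is a compact metric space $(X,d)$ with a continuous map $T:X\to X$. Let $d_n(x,y)=\max_{0\le k<n}d(T^kx,T^ky)$, and let $B_n(x,\epsilon)$, $\overline B_n(x,\epsilon)$ be the open and closed $d_n$-balls. For $Z\subset X$, $s\ge 0$, $N\in\mathbb N$ and $\epsilon>0$ define the following three entropies. Bowen entropy: let $\mathcal M^s_{N,\epsilon}(Z)=\inf\sum_i e^{-sn_i}$ over all finite or countable families $\{B_{n_i}(x_i,\epsilon)\}$ covering $Z$ with $x_i\in X$, $n_i\ge N$, and let $\mathcal M^s(Z)=\lim_{\epsilon\to0}\lim_{N\to\infty}\mathcal M^s_{N,\epsilon}(Z)$. Then $h^B(Z)=\inf\{s\ge0:\mathcal M^s(Z)=0\}\in[0,\infty]$. Packing entropy: let $P^s_{N,\epsilon}(Z)=\sup\sum_i e^{-sn_i}$ over all finite or countable pairwise disjoint families $\{\overline B_{n_i}(x_i,\epsilon)\}$ with $x_i\in Z$, $n_i\ge N$; let $P^s_\epsilon(Z)=\lim_{N\to\infty}P^s_{N,\epsilon}(Z)$, $\mathcal P^s_\epsilon(Z)=\inf\{\sum_{i=1}^\infty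 P^s_\epsilon(Z_i):\bigcup_{i=1}^\infty Z_i\supset Z\}$ and $h^P(Z,\epsilon)=\inf\{s\ge0:\mathcal P^s_\epsilon(Z)=0\}$. Then $h^P(Z)=\lim_{\epsilon\to0}h^P(Z,\epsilon)\in[0,\infty]$. Upper capacity entropy: let $r_n(Z,\epsilon)$ be the largest cardinality of a set $E\subset Z$ with $d_n(x,y)>\epsilon$ for all distinct $x,y\in E$. Then $h^U(Z)=\lim_{\epsilon\to0}\limsup_{n\to\infty}\frac1n\log r_n(Z,\epsilon)$, with $\log 0=-\infty$, so that $h^U(\emptyset)=-\infty$ (and $-\infty+\infty=-\infty$). **Theorem.** Let $(X_1,d_1,T_1)$ and $(X_2,d_2,T_2)$ be topological dynamical systems (possibly the same), and equip $X_1\times X_2$ with the map $T_1\times T_2$ and the metric $\rho((x_1,x_2),(y_1,y_2))=\max\{d_1(x_1,y_1),d_2(x_2,y_2)\}$. 1. If $h^B(X_1)<\infty$ and $h^B(X_2)<\infty$, and $Z_1\subset X_1$, $Z_2\subset X_2$ are nonempty analytic sets (continuous images of $\mathbb N^{\mathbb N}$), then $h^B(Z_1)+h^B(Z_2)\le h^B(Z_1\times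 Z_2)$. For arbitrary subsets $Z_1\subset X_1$ and $Z_2\subset X_2$: 2. $h^B(Z_1\times Z_2)\le h^B(Z_1)+h^P(Z_2)$; 3. $h^P(Z_1\times Z_2)\le h^P(Z_1)+h^P(Z_2)$; 4. $h^U(Z_1\times Z_2)\le h^U(Z_1)+h^U(Z_2)$. -/

import Mathlib

open Set Filter
open scoped NNReal ENNReal

noncomputable section

namespace ProductEntropy

variable {X : Type*} [MetricSpace X]

/-- The Bowen metric `d_n(x, y) = max {d(T^k x, T^k y) : k = 0, …, n - 1}`.
It is identically `0` for `n = 0`. -/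
def bowenDist (T : X → X) (n : ℕ) (x y : X) : ℝ≥0 :=
  (Finset.range n).sup fun k => nndist (T^[k] x) (T^[k] y)

/-- The open Bowen ball `B_n(x, ε)`. -/
def bowenBall (T : X → X) (n : ℕ) (x : X) (ε : ℝ≥0) : Set X :=
  {y | bowenDist T n x y < ε}

/-- The closed Bowen ball of order `n`. -/
def closedBowenBall (T : X → X) (n : ℕ) (x : X) (ε : ℝ≥0) : Set X :=
  {y | bowenDist T n x y ≤ ε}

/-- The weight `exp (-s n)`. -/
def expWeight (s : ℝ≥0) (n : ℕ) : ℝ≥0∞ :=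
  ENNReal.ofReal (Real.exp (-((s : ℝ) * (n : ℝ))))

/-- `M^s_{N,ε}(Z)`: the infimum of `∑ exp (-s n_i)` over the finite or countable families of
open Bowen balls `B_{n_i}(x_i, ε)` with `x_i ∈ X` and `n_i ≥ N` that cover `Z`.
A family is given by the countable set of its pairs `(x_i, n_i)`. -/
def bowenPreN (T : X → X) (s : ℝ≥0) (N : ℕ) (ε : ℝ≥0) (Z : Set X) : ℝ≥0∞ :=
  ⨅ (C : Set (X × ℕ)) (_ : C.Countable) (_ : ∀ p ∈ C, N ≤ p.2)
    (_ : Z ⊆ ⋃ p ∈ C, bowenBall T p.2 p.1 ε), ∑' p : C, expWeight s p.1.2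

/-- `M^s_ε(Z)`: the (nondecreasing) limit of `M^s_{N,ε}(Z)` as `N → ∞`. -/
def bowenPre (T : X → X) (s ε : ℝ≥0) (Z : Set X) : ℝ≥0∞ :=
  ⨆ N : ℕ, bowenPreN T s N ε Z

/-- `M^s(Z)`: the limit of `M^s_ε(Z)` as `ε` decreases to `0`, along which it does not decrease. -/
def bowenMeas (T : X → X) (s : ℝ≥0) (Z : Set X) : ℝ≥0∞ :=
  ⨆ (ε : ℝ≥0) (_ : 0 < ε), bowenPre T s ε Z

/-- Bowen's topological entropy `h^B(Z)`: the critical value of `s ≥ 0` at which `M^s(Z)` jumps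
from `∞` to `0`. -/
def bowenEntropy (T : X → X) (Z : Set X) : ℝ≥0∞ :=
  ⨅ (s : ℝ≥0) (_ : bowenMeas T s Z = 0), (s : ℝ≥0∞)

/-- `P^s_{N,ε}(Z)`: the supremum of `∑ exp (-s n_i)` over the finite or countable pairwise disjoint
families of closed Bowen balls of radius `ε` and orders `n_i ≥ N` with centers `x_i ∈ Z`.
As the balls are nonempty, distinct members of such a family have distinct pairs `(x_i, n_i)`. -/
def packPreN (T : X → X) (s : ℝ≥0) (N : ℕ) (ε : ℝ≥0) (Z : Set X) : ℝ≥0∞ :=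
  ⨆ (C : Set (X × ℕ)) (_ : C.Countable) (_ : ∀ p ∈ C, p.1 ∈ Z ∧ N ≤ p.2)
    (_ : C.PairwiseDisjoint fun p => closedBowenBall T p.2 p.1 ε), ∑' p : C, expWeight s p.1.2

/-- `P^s_ε(Z)`: the (nonincreasing) limit of `P^s_{N,ε}(Z)` as `N → ∞`. -/
def packPre (T : X → X) (s ε : ℝ≥0) (Z : Set X) : ℝ≥0∞ :=
  ⨅ N : ℕ, packPreN T s N ε Z

/-- The infimum of `∑ P^s_ε(Z_i)` over the countable covers `(Z_i)` of `Z`. -/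
def packMeas (T : X → X) (s ε : ℝ≥0) (Z : Set X) : ℝ≥0∞ :=
  ⨅ (W : ℕ → Set X) (_ : Z ⊆ ⋃ i, W i), ∑' i, packPre T s ε (W i)

/-- `h^P(Z, ε)`: the critical value of `s ≥ 0` at which `packMeas T s ε Z` jumps
from `∞` to `0`. -/
def packEntropyAt (T : X → X) (ε : ℝ≥0) (Z : Set X) : ℝ≥0∞ :=
  ⨅ (s : ℝ≥0) (_ : packMeas T s ε Z = 0), (s : ℝ≥0∞)

/-- Packing topological entropy `h^P(Z)`: the limit of `h^P(Z, ε)` as `ε` decreases to `0`,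
along which it does not decrease. -/
def packEntropy (T : X → X) (Z : Set X) : ℝ≥0∞ :=
  ⨆ (ε : ℝ≥0) (_ : 0 < ε), packEntropyAt T ε Z

/-- `E` is an `(n, ε)`-separated set of `Z`. -/
def IsSep (T : X → X) (n : ℕ) (ε : ℝ≥0) (Z E : Set X) : Prop :=
  E ⊆ Z ∧ ∀ x ∈ E, ∀ y ∈ E, x ≠ y → ε < bowenDist T n x y

/-- `r_n(Z, ε)`: the largest cardinality of an `(n, ε)`-separated set of `Z`. -/
def sepCard (T : X → X) (n : ℕ) (ε : ℝ≥0) (Z : Set X) : ℕ∞ :=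
  ⨆ (E : Set X) (_ : IsSep T n ε Z E), E.encard

/-- Upper capacity topological entropy `h^U(Z)`: the limit, as `ε` decreases to `0`, of the
(along this nondecreasing) quantity `limsup_n (1/n) log r_n(Z, ε)`.
By `log 0 = -∞` the empty set gets the value `-∞`. -/
def upperCapEntropy (T : X → X) (Z : Set X) : EReal :=
  ⨆ (ε : ℝ≥0) (_ : 0 < ε),
    limsup (fun n : ℕ => ENNReal.log ((sepCard T n ε Z : ℕ∞) : ℝ≥0∞) / (n : EReal)) atTop

end ProductEntropy

end

namespace ProductEntropy

/-! For the max metric, a Bowen ball of the product is the product of two Bowen balls of the same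
order.

Lower bound: given a cover of `Z₁ ×ˢ Z₂`, fix `z ∈ Z₁`. The balls whose first factor contains `z`
have second factors covering `Z₂`, so their weights `exp (-t n_i)` sum to at least `bowenPreN S t N
ε Z₂`. The first factors thus form a weighted cover of `Z₁`, which `bowenPreN_le_of_weighted` turns
into a genuine cover of comparable cost. No Frostman measure is needed.

Upper bounds: a set of zero packing measure splits into countably many pieces, each spanned at every
large order `n` by at most `exp (t n)` points (`exists_spanning_of_packPreN_le_one`). For the mixed
bound, multiply each ball of a cover of `Z₁` by those points. For packing, send the members of a
disjoint family injectively to pairs of spanning points of the two factors. The capacity bound is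
the same injection, with maximal separated sets as spanning sets. -/

theorem exists_maximal_pairwise {α : Type*} {r : α → α → Prop} (hr : ∀ x y, r x y → r y x)
    (Z : Set α) :
    ∃ E ⊆ Z, E.Pairwise r ∧ ∀ y ∈ Z, y ∉ E → ∃ x ∈ E, ¬ r x y := by
  obtain ⟨E, ⟨hEZ, hEr⟩, hmax⟩ := zorn_subset {E : Set α | E ⊆ Z ∧ E.Pairwise r}
    (fun c hc hchain => ⟨⋃₀ c, ⟨sUnion_subset fun s hs => (hc hs).1,
      (pairwise_sUnion hchain.directedOn).2 fun s hs => (hc hs).2⟩,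
      fun s hs => subset_sUnion_of_mem hs⟩)
  refine ⟨E, hEZ, hEr, fun y hy hyE => ?_⟩
  by_contra! h
  have hins : insert y E ∈ {E : Set α | E ⊆ Z ∧ E.Pairwise r} := by
    refine ⟨insert_subset hy hEZ, ?_⟩
    rw [pairwise_insert]
    exact ⟨hEr, fun b hb _ => ⟨hr _ _ (h b hb), h b hb⟩⟩
  exact hyE (hmax hins (subset_insert y E) (mem_insert y E))

/-- Double counting: if each set `B i` meets `E` in at most one point, and each point of `E`
receives total weight at least `a`, then `a * #E` is at most the total weight. -/
theorem tsum_const_le_tsum_of_subsingleton {α ι : Type*} {E : Set α} {a : ℝ≥0∞} {B : ι → Set α}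
    {c : ι → ℝ≥0∞} (h₁ : ∀ x ∈ E, a ≤ ∑' i, (B i).indicator (fun _ => c i) x)
    (h₂ : ∀ i, (E ∩ B i).Subsingleton) : ∑' _ : E, a ≤ ∑' i, c i := by
  calc ∑' _ : E, a ≤ ∑' x : E, ∑' i, (B i).indicator (fun _ => c i) (x : α) :=
        ENNReal.tsum_le_tsum fun x => h₁ x x.2
    _ = ∑' i, ∑' x : E, (B i).indicator (fun _ => c i) (x : α) := ENNReal.tsum_comm
    _ ≤ ∑' i, c i := by
        refine ENNReal.tsum_le_tsum fun i => ?_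
        by_cases h : ∃ x : E, (x : α) ∈ B i
        · obtain ⟨x, hx⟩ := h
          rw [tsum_eq_single x]
          · exact indicator_le_self _ _ _
          · intro y hy
            refine indicator_of_notMem (fun hyB => hy ?_) _
            exact Subtype.ext (h₂ i ⟨y.2, hyB⟩ ⟨x.2, hx⟩)
        · push Not at h
          have : ∀ x : E, (B i).indicator (fun _ => c i) (x : α) = 0 :=
            fun x => indicator_of_notMem (h x) _
          simp [this]

theorem countable_of_tsum_const_ne_top {α : Type*} {E : Set α} {a : ℝ≥0∞} (ha : a ≠ 0)
    (h : ∑' _ : E, a ≠ ⊤) : E.Countable := by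
  by_contra hE
  have : Infinite E := infinite_coe_iff.2 fun hf => hE hf.countable
  exact h (ENNReal.tsum_const_eq_top_of_ne_zero ha)

/-! ### Exponential weights. -/

section Weight

theorem expWeight_eq_pow (s : ℝ≥0) (n : ℕ) :
    expWeight s n = ENNReal.ofReal (Real.exp (-(s : ℝ))) ^ n := by
  rw [expWeight, ← ENNReal.ofReal_pow (Real.exp_pos _).le, ← Real.exp_nat_mul]
  congr 2
  ring

theorem expWeight_ne_zero (s : ℝ≥0) (n : ℕ) : expWeight s n ≠ 0 := by
  simp [expWeight, Real.exp_pos]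

theorem expWeight_add (s t : ℝ≥0) (n : ℕ) :
    expWeight (s + t) n = expWeight s n * expWeight t n := by
  rw [expWeight, expWeight, expWeight, ← ENNReal.ofReal_mul (Real.exp_pos _).le, ← Real.exp_add]
  congr 2
  push_cast
  ring

theorem expWeight_anti {s t : ℝ≥0} (h : s ≤ t) (n : ℕ) : expWeight t n ≤ expWeight s n := by
  refine ENNReal.ofReal_le_ofReal (Real.exp_le_exp.2 (neg_le_neg ?_))
  gcongr

theorem tsum_expWeight_ne_top {s : ℝ≥0} (hs : 0 < s) : ∑' n, expWeight s n ≠ ⊤ := by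
  simp_rw [expWeight_eq_pow, ENNReal.tsum_geometric]
  refine ENNReal.inv_ne_top.2 (tsub_pos_of_lt ?_).ne'
  rw [ENNReal.ofReal_lt_one]
  simpa using hs

end Weight

/-! ### Bowen metrics and their products. -/

section Dist

variable {X Y : Type*} [MetricSpace X] [MetricSpace Y] (T : X → X) (S : Y → Y)

@[simp] theorem bowenDist_self (n : ℕ) (x : X) : bowenDist T n x x = 0 := by
  simp [bowenDist]

theorem bowenDist_comm (n : ℕ) (x y : X) : bowenDist T n x y = bowenDist T n y x := by
  simp [bowenDist, nndist_comm]

theorem bowenDist_triangle (n : ℕ) (x y z : X) :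
    bowenDist T n x z ≤ bowenDist T n x y + bowenDist T n y z := by
  refine Finset.sup_le fun k hk => (nndist_triangle _ (T^[k] y) _).trans ?_
  exact add_le_add (Finset.le_sup (f := fun k => nndist (T^[k] x) (T^[k] y)) hk)
    (Finset.le_sup (f := fun k => nndist (T^[k] y) (T^[k] z)) hk)

theorem bowenDist_prod (n : ℕ) (p q : X × Y) :
    bowenDist (Prod.map T S) n p q = max (bowenDist T n p.1 q.1) (bowenDist S n p.2 q.2) := by
  have h : ∀ a b : X × Y, nndist a b = nndist a.1 b.1 ⊔ nndist a.2 b.2 := fun _ _ => rfl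
  simp only [bowenDist, Prod.map_iterate, h, Prod.map_fst, Prod.map_snd]
  exact Finset.sup_sup

end Dist

/-! ### Monotonicity, critical exponents and spanning sets. -/

section Basic

variable {X Y : Type*} [MetricSpace X] [MetricSpace Y] (T : X → X) (S : Y → Y)

/-- Repeated balls collapse when the family becomes a set of pairs, which only lowers the sum. This
lets covers be indexed by arbitrary countable types. -/
theorem bowenPreN_le_tsum {ι : Type*} [Countable ι] {s : ℝ≥0} {N : ℕ} {ε : ℝ≥0} {Z : Set X}
    (x : ι → X) (n : ι → ℕ) (hn : ∀ i, N ≤ n i)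
    (hZ : ∀ z ∈ Z, ∃ i, bowenDist T (n i) (x i) z < ε) :
    bowenPreN T s N ε Z ≤ ∑' i, expWeight s (n i) := by
  set f : ι → X × ℕ := fun i => (x i, n i)
  calc bowenPreN T s N ε Z ≤ ∑' p : range f, expWeight s p.1.2 := by
        refine iInf_le_of_le (range f) (iInf_le_of_le (countable_range f)
          (iInf_le_of_le ?_ (iInf_le _ ?_)))
        · rintro _ ⟨i, rfl⟩
          exact hn i
        · intro z hz
          obtain ⟨i, hi⟩ := hZ z hz
          exact mem_biUnion (mem_range_self i) hi
    _ = ∑' p : range f, expWeight s (n (rangeSplitting f p)) := by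
        refine tsum_congr fun p => ?_
        have := apply_rangeSplitting f p
        rw [← this]
    _ ≤ ∑' i, expWeight s (n i) :=
        ENNReal.tsum_comp_le_tsum_of_injective (rangeSplitting_injective f)
          fun i => expWeight s (n i)

theorem bowenPreN_mono_left {s : ℝ≥0} {N N' : ℕ} (h : N ≤ N') (ε : ℝ≥0) (Z : Set X) :
    bowenPreN T s N ε Z ≤ bowenPreN T s N' ε Z := by
  refine le_iInf fun C => le_iInf fun hC => le_iInf fun hN => le_iInf fun hZ => ?_
  exact iInf_le_of_le C (iInf_le_of_le hC (iInf_le_of_le (fun p hp => h.trans (hN p hp))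
    (iInf_le _ hZ)))

theorem bowenPreN_anti_radius {s : ℝ≥0} (N : ℕ) {ε ε' : ℝ≥0} (h : ε ≤ ε') (Z : Set X) :
    bowenPreN T s N ε' Z ≤ bowenPreN T s N ε Z := by
  refine le_iInf fun C => le_iInf fun hC => le_iInf fun hN => le_iInf fun hZ => ?_
  refine iInf_le_of_le C (iInf_le_of_le hC (iInf_le_of_le hN (iInf_le _ (hZ.trans ?_))))
  exact iUnion₂_mono fun p _ z hz => lt_of_lt_of_le hz h

theorem bowenMeas_eq_zero_iff {s : ℝ≥0} {Z : Set X} :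
    bowenMeas T s Z = 0 ↔ ∀ ε, 0 < ε → ∀ N, bowenPreN T s N ε Z = 0 := by
  simp [bowenMeas, bowenPre]

theorem bowenMeas_anti {s t : ℝ≥0} (h : s ≤ t) (Z : Set X) :
    bowenMeas T t Z ≤ bowenMeas T s Z :=
  iSup₂_mono fun _ _ => iSup_mono fun _ => iInf_mono fun _ => iInf_mono fun _ => iInf_mono fun _ =>
    iInf_mono fun _ => ENNReal.tsum_le_tsum fun _ => expWeight_anti h _

theorem bowenMeas_eq_zero_of_lt {s : ℝ≥0} {Z : Set X} (h : bowenEntropy T Z < s) :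
    bowenMeas T s Z = 0 := by
  simp only [bowenEntropy, iInf_lt_iff] at h
  obtain ⟨t, ht, hts⟩ := h
  exact le_antisymm ((bowenMeas_anti T (by exact_mod_cast hts.le) Z).trans ht.le) zero_le

theorem bowenMeas_ne_zero_of_lt {s : ℝ≥0} {Z : Set X} (h : s < bowenEntropy T Z) :
    bowenMeas T s Z ≠ 0 :=
  fun h0 => (iInf₂_le (f := fun (s : ℝ≥0) (_ : bowenMeas T s Z = 0) => (s : ℝ≥0∞)) s h0).not_gt h

theorem packPreN_anti {s t : ℝ≥0} (h : s ≤ t) (N : ℕ) (ε : ℝ≥0) (Z : Set X) :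
    packPreN T t N ε Z ≤ packPreN T s N ε Z :=
  iSup_mono fun _ => iSup_mono fun _ => iSup_mono fun _ => iSup_mono fun _ =>
    ENNReal.tsum_le_tsum fun _ => expWeight_anti h _

theorem packPreN_anti_left (s : ℝ≥0) {N N' : ℕ} (h : N ≤ N') (ε : ℝ≥0) (Z : Set X) :
    packPreN T s N' ε Z ≤ packPreN T s N ε Z := by
  refine iSup_le fun C => iSup_le fun hC => iSup_le fun hN => iSup_le fun hd => ?_
  exact le_iSup_of_le C (le_iSup_of_le hC (le_iSup_of_le
    (fun p hp => ⟨(hN p hp).1, h.trans (hN p hp).2⟩) (le_iSup_of_le hd le_rfl)))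

theorem packMeas_anti {s t : ℝ≥0} (h : s ≤ t) (ε : ℝ≥0) (Z : Set X) :
    packMeas T t ε Z ≤ packMeas T s ε Z :=
  iInf₂_mono fun _ _ => ENNReal.tsum_le_tsum fun _ => iInf_mono fun _ => packPreN_anti T h _ _ _

theorem packMeas_eq_zero_of_lt {s ε : ℝ≥0} {Z : Set X} (h : packEntropyAt T ε Z < s) :
    packMeas T s ε Z = 0 := by
  simp only [packEntropyAt, iInf_lt_iff] at h
  obtain ⟨t, ht, hts⟩ := h
  exact le_antisymm ((packMeas_anti T (by exact_mod_cast hts.le) ε Z).trans ht.le) zero_le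

/-- A set of vanishing packing measure is a countable union of sets with bounded packing sums. -/
theorem exists_cover_of_packMeas_eq_zero {s ε : ℝ≥0} {Z : Set X} (h : packMeas T s ε Z = 0) :
    ∃ W : ℕ → Set X, Z ⊆ ⋃ i, W i ∧ ∀ i, ∃ N, packPreN T s N ε (W i) ≤ 1 := by
  have h1 : packMeas T s ε Z < 1 := h ▸ one_pos
  simp only [packMeas, iInf_lt_iff] at h1
  obtain ⟨W, hW, hlt⟩ := h1
  refine ⟨W, hW, fun i => ?_⟩
  have := (ENNReal.le_tsum i).trans_lt hlt
  simp only [packPre, iInf_lt_iff] at this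
  exact this.imp fun N hN => hN.le

/-- If the packing sums of `W` are bounded by `1`, then `W` is spanned at every large order `n`
by at most `exp (s n)` of its points. -/
theorem exists_spanning_of_packPreN_le_one {s ε : ℝ≥0} {N : ℕ} {W : Set X}
    (h : packPreN T s N ε W ≤ 1) {n : ℕ} (hn : N ≤ n) :
    ∃ E ⊆ W, E.Countable ∧ (∀ y ∈ W, ∃ x ∈ E, bowenDist T n x y ≤ 2 * ε) ∧
      ∑' _ : E, expWeight s n ≤ 1 := by
  obtain ⟨E, hEW, hEd, hmax⟩ := exists_maximal_pairwise
    (r := fun x y => Disjoint (closedBowenBall T n x ε) (closedBowenBall T n y ε))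
    (fun _ _ h => h.symm) W
  have key : ∀ F ⊆ E, F.Countable → ∑' _ : F, expWeight s n ≤ 1 := by
    intro F hF hFc
    have hinj : Function.Injective fun x : X => (x, n) := fun _ _ h => (Prod.ext_iff.1 h).1
    calc ∑' _ : F, expWeight s n
        = ∑' p : (fun x : X => (x, n)) '' F, expWeight s n :=
          ((Equiv.Set.image _ F hinj).tsum_eq fun _ => expWeight s n)
      _ = ∑' p : (fun x : X => (x, n)) '' F, expWeight s p.1.2 := by
          refine tsum_congr ?_
          rintro ⟨_, x, _, rfl⟩
          rfl
      _ ≤ packPreN T s N ε W := by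
          refine le_iSup_of_le _ (le_iSup_of_le (hFc.image _) (le_iSup_of_le ?_
            (le_iSup_of_le ?_ le_rfl)))
          · rintro _ ⟨x, hx, rfl⟩
            exact ⟨hEW (hF hx), hn⟩
          · rintro _ ⟨x, hx, rfl⟩ _ ⟨y, hy, rfl⟩ hxy
            exact hEd (hF hx) (hF hy) fun h => hxy (by rw [h])
      _ ≤ 1 := h
  -- Packing sums see only countable families, so `key` is applied to a countably infinite part of
  -- `E`, whose sum would be infinite.
  have hcount : E.Countable := by
    by_contra hE
    have hinf : E.Infinite := fun hf => hE hf.countable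
    set g : ℕ → X := fun k => (hinf.natEmbedding E k : X)
    have hg : Function.Injective g :=
      Subtype.val_injective.comp (hinf.natEmbedding E).injective
    have : Infinite (range g) := (infinite_range_of_injective hg).to_subtype
    have hle := key (range g) (by rintro _ ⟨k, rfl⟩; exact (hinf.natEmbedding E k).2)
      (countable_range g)
    rw [ENNReal.tsum_const_eq_top_of_ne_zero (expWeight_ne_zero s n)] at hle
    exact absurd hle (by simp)
  refine ⟨E, hEW, hcount, fun y hy => ?_, key E Subset.rfl hcount⟩
  by_cases hyE : y ∈ E
  · exact ⟨y, hyE, by simp⟩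
  · obtain ⟨x, hx, hxy⟩ := hmax y hy hyE
    obtain ⟨z, hzx, hzy⟩ := not_disjoint_iff.1 hxy
    refine ⟨x, hx, (bowenDist_triangle T n x z y).trans ?_⟩
    rw [two_mul]
    refine add_le_add hzx ?_
    rw [bowenDist_comm]
    exact hzy

end Basic

/-! ### Weighted covers and the lower bound for Bowen entropy. -/

section Frostman

variable {X Y : Type*} [MetricSpace X] [MetricSpace Y] (T : X → X) (S : Y → Y)

/-- Weighted covers by Bowen balls are, up to a constant, a factor `2` in the radius and an
arbitrarily small loss in the exponent, as expensive as covers. -/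
theorem bowenPreN_le_of_weighted {ι : Type*} {s δ ε : ℝ≥0} (hδ : 0 < δ) (hε : 0 < ε)
    {a : ℝ≥0∞} (ha : a ≠ 0) (ha' : a ≠ ⊤) {N : ℕ} {Z : Set X} (x : ι → X) (n : ι → ℕ)
    (c : ι → ℝ≥0∞) (hn : ∀ i, N ≤ n i)
    (hZ : ∀ z ∈ Z, a ≤ ∑' i, (bowenBall T (n i) (x i) ε).indicator (fun _ => c i) z) :
    bowenPreN T (s + δ) N (2 * ε) Z
      ≤ 2 * (∑' k, expWeight δ k) * a⁻¹ * ∑' i, c i * expWeight s (n i) := by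
  set G : ℝ≥0∞ := ∑' k, expWeight δ k with hG
  have hG0 : G ≠ 0 := fun h => expWeight_ne_zero δ 0 (ENNReal.tsum_eq_zero.1 h 0)
  have hGt : G ≠ ⊤ := tsum_expWeight_ne_top hδ
  set K : ℝ≥0∞ := 2 * G * a⁻¹ with hK
  have hK0 : K ≠ 0 := by simp [hK, hG0, ha']
  have hKt : K ≠ ⊤ := ENNReal.mul_ne_top (ENNReal.mul_ne_top (by simp) hGt) (by simpa using ha)
  by_cases htop : ∑' i, c i * expWeight s (n i) = ⊤
  · rw [htop, ENNReal.mul_top hK0]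
    exact le_top
  -- These thresholds sum to `a / 2 < a`, so at every `z ∈ Z` the balls of some single order `k`
  -- carry weight at least `θ k`. The loss `δ` in the exponent pays for this summability.
  set θ : ℕ → ℝ≥0∞ := fun k => K⁻¹ * expWeight δ k with hθ
  have hθ0 : ∀ k, θ k ≠ 0 := fun k =>
    mul_ne_zero (ENNReal.inv_ne_zero.2 hKt) (expWeight_ne_zero δ k)
  have hθsum : ∑' k, θ k < a := by
    rw [ENNReal.tsum_mul_left, ← hG]
    have h1 : K⁻¹ * G = a / 2 := by
      rw [hK, ENNReal.mul_inv (.inr (ENNReal.inv_ne_top.2 ha))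
        (.inr (ENNReal.inv_ne_zero.2 ha')), inv_inv,
        ENNReal.mul_inv (by simp) (by simp), mul_right_comm, mul_assoc 2⁻¹,
        ENNReal.inv_mul_cancel hG0 hGt, mul_one, mul_comm, div_eq_mul_inv]
    rw [h1]
    exact ENNReal.half_lt_self ha ha'
  have hfib : ∀ f : ι → ℝ≥0∞, ∑' k : ℕ, ∑' i : {i // n i = k}, f i = ∑' i, f i := by
    intro f
    rw [← (Equiv.sigmaFiberEquiv n).tsum_eq f, ENNReal.tsum_sigma']
    rfl
  set W : ℕ → Set X := fun k => {z | z ∈ Z ∧ θ k ≤ ∑' i : {i // n i = k},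
    (bowenBall T (n i) (x i) ε).indicator (fun _ => c i) z} with hW
  have hcover : ∀ z ∈ Z, ∃ k, z ∈ W k := by
    intro z hz
    by_contra! hno
    refine absurd (hZ z hz) (not_le.2 (lt_of_le_of_lt ?_ hθsum))
    rw [← hfib]
    refine ENNReal.tsum_le_tsum fun k => ?_
    by_contra hk
    exact hno k ⟨hz, (not_le.1 hk).le⟩
  have hWN : ∀ k, (W k).Nonempty → N ≤ k := by
    rintro k ⟨z, _, hz⟩
    by_contra hk
    have : IsEmpty {i // n i = k} := ⟨fun i => hk (i.2 ▸ hn i)⟩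
    rw [tsum_empty] at hz
    exact hθ0 k (le_antisymm hz zero_le)
  choose E hEW hEr hEmax using fun k =>
    exists_maximal_pairwise (r := fun y z => 2 * ε ≤ bowenDist T k y z)
      (fun y z h => by rwa [bowenDist_comm]) (W k)
  have hEsum : ∀ k, ∑' _ : E k, θ k ≤ ∑' i : {i // n i = k}, c i := by
    intro k
    refine tsum_const_le_tsum_of_subsingleton
      (B := fun i : {i // n i = k} => bowenBall T (n i) (x i) ε)
      (fun z hz => (hEW k hz).2) ?_
    -- Two points of one open ball of radius `ε` are less than `2 * ε` apart, so the ball holds at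
    -- most one point of `E k`.
    rintro ⟨i, rfl⟩ y ⟨hy, hyi⟩ z ⟨hz, hzi⟩
    by_contra hyz
    refine absurd (hEr _ hy hz hyz) (not_le.2 ?_)
    refine (bowenDist_triangle T _ y (x i) z).trans_lt ?_
    rw [two_mul, bowenDist_comm T _ y]
    exact add_lt_add hyi hzi
  have hterm : ∀ k, ∑' _ : E k, expWeight (s + δ) k
      ≤ K * ∑' i : {i // n i = k}, c i * expWeight s (n i) := by
    intro k
    have h1 : expWeight (s + δ) k = (K * expWeight s k) * θ k := by
      rw [expWeight_add, hθ, mul_mul_mul_comm, ENNReal.mul_inv_cancel hK0 hKt, one_mul]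
    have h2 : ∑' i : {i // n i = k}, c i * expWeight s (n i)
        = (∑' i : {i // n i = k}, c i) * expWeight s k := by
      rw [← ENNReal.tsum_mul_right]
      exact tsum_congr fun i => by rw [i.2]
    rw [h1, ENNReal.tsum_mul_left, h2, mul_comm (tsum _) (expWeight s k), ← mul_assoc]
    gcongr
    exact hEsum k
  have hsum : ∑' k, ∑' _ : E k, expWeight (s + δ) k ≤ K * ∑' i, c i * expWeight s (n i) := by
    rw [← hfib fun i => c i * expWeight s (n i), ← ENNReal.tsum_mul_left]
    exact ENNReal.tsum_le_tsum hterm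
  have hEc : ∀ k, (E k).Countable := fun k =>
    countable_of_tsum_const_ne_top (expWeight_ne_zero (s + δ) k)
      (ne_top_of_le_ne_top (ENNReal.mul_ne_top hKt htop) ((ENNReal.le_tsum k).trans hsum))
  have : ∀ k, Countable (E k) := fun k => (hEc k).to_subtype
  refine (bowenPreN_le_tsum T (ι := Σ k, E k) (fun p => p.2) (fun p => p.1)
    (fun p => hWN _ ⟨_, hEW _ p.2.2⟩) fun z hz => ?_).trans ?_
  · obtain ⟨k, hk⟩ := hcover z hz
    by_cases hzE : z ∈ E k
    · exact ⟨⟨k, z, hzE⟩, by simpa using hε⟩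
    · obtain ⟨y, hy, hyz⟩ := hEmax k z hk hzE
      exact ⟨⟨k, y, hy⟩, not_le.1 hyz⟩
  · rw [ENNReal.tsum_sigma']
    exact hsum

/-- Give the first factor of a product ball of order `n` the weight `exp (-t n)`: covering the slice
over each `z` makes the total weight at `z` bounded below. -/
theorem bowenPreN_add_eq_zero_left {s t δ ε : ℝ≥0} (hδ : 0 < δ) (hε : 0 < ε) {N : ℕ}
    {Z₁ : Set X} {Z₂ : Set Y} (h₂ : bowenPreN S t N ε Z₂ ≠ 0)
    (h : bowenPreN (Prod.map T S) (s + t) N ε (Z₁ ×ˢ Z₂) = 0) :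
    bowenPreN T (s + δ) N (2 * ε) Z₁ = 0 := by
  -- The truncation at `1` keeps `a` finite, as the weighted cover lemma requires.
  set a : ℝ≥0∞ := min 1 (bowenPreN S t N ε Z₂) with ha
  have ha0 : a ≠ 0 := by
    rw [ha]
    exact (lt_min one_pos (pos_iff_ne_zero.2 h₂)).ne'
  have hat : a ≠ ⊤ := ne_top_of_le_ne_top ENNReal.one_ne_top (min_le_left _ _)
  set K : ℝ≥0∞ := 2 * (∑' k, expWeight δ k) * a⁻¹ with hK
  have hKt : K ≠ ⊤ := ENNReal.mul_ne_top (ENNReal.mul_ne_top (by simp)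
    (tsum_expWeight_ne_top hδ)) (by simpa using ha0)
  have hle : bowenPreN T (s + δ) N (2 * ε) Z₁ / K
      ≤ bowenPreN (Prod.map T S) (s + t) N ε (Z₁ ×ˢ Z₂) := by
    refine le_iInf fun C => le_iInf fun hC => le_iInf fun hN => le_iInf fun hZ => ?_
    have := hC.to_subtype
    refine ENNReal.div_le_of_le_mul' ((bowenPreN_le_of_weighted T (ι := C) hδ hε ha0 hat
      (fun p => p.1.1.1) (fun p => p.1.2) (fun p => expWeight t p.1.2) (fun p => hN _ p.2)
      fun z hz => ?_).trans_eq ?_)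
    · refine (min_le_right _ _).trans ((bowenPreN_le_tsum S
        (ι := {p : C | z ∈ bowenBall T p.1.2 p.1.1.1 ε}) (fun p => p.1.1.1.2) (fun p => p.1.1.2)
        (fun p => hN _ p.1.2) fun w hw => ?_).trans_eq ?_)
      · obtain ⟨p, hp, hpz⟩ := mem_iUnion₂.1 (hZ (mk_mem_prod hz hw))
        have hpz' : bowenDist (Prod.map T S) p.2 p.1 (z, w) < ε := hpz
        rw [bowenDist_prod, max_lt_iff] at hpz'
        exact ⟨⟨⟨p, hp⟩, hpz'.1⟩, hpz'.2⟩
      · rw [tsum_subtype {p : C | z ∈ bowenBall T p.1.2 p.1.1.1 ε} fun p => expWeight t p.1.2]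
        rfl
    · simp_rw [add_comm s t, expWeight_add, hK]
  rw [h, nonpos_iff_eq_zero, ENNReal.div_eq_zero_iff] at hle
  exact hle.resolve_right hKt

theorem bowenEntropy_le_prod_left (Z₁ : Set X) {Z₂ : Set Y} (h₂ : Z₂.Nonempty) :
    bowenEntropy T Z₁ ≤ bowenEntropy (Prod.map T S) (Z₁ ×ˢ Z₂) := by
  obtain ⟨w, hw⟩ := h₂
  refine le_iInf₂ fun u hu => iInf₂_le u ?_
  rw [bowenMeas_eq_zero_iff] at hu ⊢
  intro ε hε N
  refine le_antisymm ((hu ε hε N).symm ▸ ?_) zero_le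
  refine le_iInf fun C => le_iInf fun hC => le_iInf fun hN => le_iInf fun hZ => ?_
  have := hC.to_subtype
  refine bowenPreN_le_tsum T (ι := C) (fun p => p.1.1.1) (fun p => p.1.2) (fun p => hN _ p.2)
    fun z hz => ?_
  obtain ⟨p, hp, hpz⟩ := mem_iUnion₂.1 (hZ (mk_mem_prod hz hw))
  have hpz' : bowenDist (Prod.map T S) p.2 p.1 (z, w) < ε := hpz
  rw [bowenDist_prod, max_lt_iff] at hpz'
  exact ⟨⟨p, hp⟩, hpz'.1⟩

theorem bowenEntropy_le_prod_right {Z₁ : Set X} (h₁ : Z₁.Nonempty) (Z₂ : Set Y) :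
    bowenEntropy S Z₂ ≤ bowenEntropy (Prod.map T S) (Z₁ ×ˢ Z₂) := by
  obtain ⟨w, hw⟩ := h₁
  refine le_iInf₂ fun u hu => iInf₂_le u ?_
  rw [bowenMeas_eq_zero_iff] at hu ⊢
  intro ε hε N
  refine le_antisymm ((hu ε hε N).symm ▸ ?_) zero_le
  refine le_iInf fun C => le_iInf fun hC => le_iInf fun hN => le_iInf fun hZ => ?_
  have := hC.to_subtype
  refine bowenPreN_le_tsum S (ι := C) (fun p => p.1.1.2) (fun p => p.1.2) (fun p => hN _ p.2)
    fun z hz => ?_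
  obtain ⟨p, hp, hpz⟩ := mem_iUnion₂.1 (hZ (mk_mem_prod hw hz))
  have hpz' : bowenDist (Prod.map T S) p.2 p.1 (w, z) < ε := hpz
  rw [bowenDist_prod, max_lt_iff] at hpz'
  exact ⟨⟨p, hp⟩, hpz'.2⟩

/-- The lower bound for the Bowen entropy of a product holds for arbitrary nonempty sets: a cover of
`Z₁ ×ˢ Z₂` projects to a weighted cover of `Z₁`, so neither analyticity nor finiteness of the entropy
of the ambient systems is needed. -/
theorem bowenEntropy_add_le_prod {Z₁ : Set X} {Z₂ : Set Y} (h₁ : Z₁.Nonempty)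
    (h₂ : Z₂.Nonempty) :
    bowenEntropy T Z₁ + bowenEntropy S Z₂ ≤ bowenEntropy (Prod.map T S) (Z₁ ×ˢ Z₂) := by
  -- Choosing `s` and `t` strictly below the two entropies needs both to be positive; otherwise
  -- projecting to one factor suffices.
  by_cases ha : bowenEntropy T Z₁ = 0
  · rw [ha, zero_add]
    exact bowenEntropy_le_prod_right T S h₁ Z₂
  by_cases hb : bowenEntropy S Z₂ = 0
  · rw [hb, add_zero]
    exact bowenEntropy_le_prod_left T S Z₁ h₂
  refine le_iInf₂ fun u hu => not_lt.1 fun hlt => ?_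
  obtain ⟨s, hs, t, ht, hst⟩ := ENNReal.exists_lt_add_of_lt_add hlt ha hb
  lift s to ℝ≥0 using hs.ne_top
  lift t to ℝ≥0 using ht.ne_top
  obtain ⟨s', hss', hs'⟩ := ENNReal.lt_iff_exists_nnreal_btwn.1 hs
  have hss' : s < s' := by exact_mod_cast hss'
  have hu' : bowenMeas (Prod.map T S) (s + t) (Z₁ ×ˢ Z₂) = 0 :=
    le_antisymm ((bowenMeas_anti _ (by exact_mod_cast hst.le) _).trans hu.le) zero_le
  have hT := bowenMeas_ne_zero_of_lt T hs'
  have hS := bowenMeas_ne_zero_of_lt S ht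
  rw [Ne, bowenMeas_eq_zero_iff] at hT hS
  push Not at hT hS
  obtain ⟨ε₁, hε₁, N₁, h1⟩ := hT
  obtain ⟨ε₂, hε₂, N₂, h2⟩ := hS
  -- Halving `ε₁` absorbs the doubled radius in the first factor.
  set ε := min (ε₁ / 2) ε₂ with hε
  set N := max N₁ N₂
  have hε0 : 0 < ε := lt_min (half_pos hε₁) hε₂
  have hS' : bowenPreN S t N ε Z₂ ≠ 0 := fun h0 => h2 <| le_antisymm (h0 ▸
    (bowenPreN_anti_radius S N₂ (min_le_right _ _) Z₂).trans
      (bowenPreN_mono_left S (le_max_right _ _) ε Z₂)) zero_le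
  have h0 := bowenPreN_add_eq_zero_left T S (tsub_pos_of_lt hss') hε0 hS'
    ((bowenMeas_eq_zero_iff _).1 hu' ε hε0 N)
  rw [add_tsub_cancel_of_le hss'.le] at h0
  have h2ε : 2 * ε ≤ ε₁ := by
    have := min_le_left (ε₁ / 2) ε₂
    rw [mul_comm]
    exact (le_div_iff₀ two_pos).1 this
  exact h1 <| le_antisymm (h0 ▸ (bowenPreN_anti_radius T N₁ h2ε Z₁).trans
      (bowenPreN_mono_left T (le_max_left _ _) _ Z₁)) zero_le

end Frostman

/-! ### Upper bounds for Bowen and packing entropy. -/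

section Upper

variable {X Y : Type*} [MetricSpace X] [MetricSpace Y] (T : X → X) (S : Y → Y)

theorem bowenPreN_iUnion_eq_zero {s : ℝ≥0} {N : ℕ} {ε : ℝ≥0} {Z : Set X} {V : ℕ → Set X}
    (hZ : Z ⊆ ⋃ i, V i) (h : ∀ i, bowenPreN T s N ε (V i) = 0) : bowenPreN T s N ε Z = 0 := by
  refine le_antisymm (ENNReal.le_of_forall_pos_le_add fun η hη _ => ?_) zero_le
  obtain ⟨η', hη', hsum⟩ := ENNReal.exists_pos_sum_of_countable
    (ENNReal.coe_ne_zero.2 hη.ne') ℕ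
  have : ∀ i, ∃ C : Set (X × ℕ), C.Countable ∧ (∀ p ∈ C, N ≤ p.2) ∧
      (V i ⊆ ⋃ p ∈ C, bowenBall T p.2 p.1 ε) ∧ ∑' p : C, expWeight s p.1.2 < η' i := by
    intro i
    have hlt : bowenPreN T s N ε (V i) < η' i := by
      rw [h i]
      exact_mod_cast hη' i
    simpa only [bowenPreN, iInf_lt_iff, exists_prop] using hlt
  choose C hC hN hV hlt using this
  have := fun i => (hC i).to_subtype
  refine (bowenPreN_le_tsum T (ι := Σ i, C i) (fun p => p.2.1.1) (fun p => p.2.1.2)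
    (fun p => hN _ _ p.2.2) fun z hz => ?_).trans ?_
  · obtain ⟨i, hi⟩ := mem_iUnion.1 (hZ hz)
    obtain ⟨p, hp, hpz⟩ := mem_iUnion₂.1 (hV i hi)
    exact ⟨⟨i, p, hp⟩, hpz⟩
  · rw [ENNReal.tsum_sigma', zero_add]
    exact (ENNReal.tsum_le_tsum fun i => (hlt i).le).trans hsum.le

/-- Each ball of order `n` is replaced by at most `exp (t n)` product balls, which the extra factor
`exp (-t n)` pays for. Spanning holds within `2 * ε`, non-strictly; radius `3 * ε` makes the balls
open. -/
theorem bowenPreN_prod_le {s t ε : ℝ≥0} (hε : 0 < ε) {N : ℕ} {Z : Set X} {W : Set Y}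
    (h : packPreN S t N ε W ≤ 1) :
    bowenPreN (Prod.map T S) (s + t) N (3 * ε) (Z ×ˢ W) ≤ bowenPreN T s N (3 * ε) Z := by
  refine le_iInf fun C => le_iInf fun hC => le_iInf fun hN => le_iInf fun hZ => ?_
  have := hC.to_subtype
  choose E _ hEc hE hEs using fun p : C => exists_spanning_of_packPreN_le_one S h (hN _ p.2)
  have := fun p => (hEc p).to_subtype
  refine (bowenPreN_le_tsum (Prod.map T S) (ι := Σ p : C, E p) (fun q => (q.1.1.1, q.2))
    (fun q => q.1.1.2) (fun q => hN _ q.1.2) ?_).trans ?_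
  · rintro ⟨z, w⟩ ⟨hz, hw⟩
    obtain ⟨p, hp, hpz⟩ := mem_iUnion₂.1 (hZ hz)
    obtain ⟨x, hx, hxw⟩ := hE ⟨p, hp⟩ w hw
    refine ⟨⟨⟨p, hp⟩, x, hx⟩, ?_⟩
    rw [bowenDist_prod]
    refine max_lt hpz (hxw.trans_lt ?_)
    gcongr
    norm_num
  · rw [ENNReal.tsum_sigma']
    refine ENNReal.tsum_le_tsum fun p => ?_
    simp only [expWeight_add, ENNReal.tsum_mul_left]
    exact mul_le_of_le_one_right' (hEs p)

theorem bowenEntropy_prod_le (Z₁ : Set X) (Z₂ : Set Y) :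
    bowenEntropy (Prod.map T S) (Z₁ ×ˢ Z₂) ≤ bowenEntropy T Z₁ + packEntropy S Z₂ := by
  refine le_of_forall_gt fun r hr => ?_
  obtain ⟨s, t, hs, ht, hst⟩ : ∃ s t : ℝ≥0, bowenEntropy T Z₁ < s ∧ packEntropy S Z₂ < t ∧
      ((s + t : ℝ≥0) : ℝ≥0∞) < r := by
    obtain ⟨s, hs, t, ht, hst⟩ := ENNReal.exists_add_lt_of_add_lt hr
    lift s to ℝ≥0 using ne_top_of_le_ne_top hst.ne_top le_self_add
    lift t to ℝ≥0 using ne_top_of_le_ne_top hst.ne_top le_add_self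
    exact ⟨s, t, hs, ht, by exact_mod_cast hst⟩
  refine lt_of_le_of_lt (iInf₂_le (s + t) ?_) hst
  rw [bowenMeas_eq_zero_iff]
  intro ε₀ hε₀ N
  obtain ⟨ε, hε, rfl⟩ : ∃ ε : ℝ≥0, 0 < ε ∧ ε₀ = 3 * ε :=
    ⟨ε₀ / 3, by positivity, by field_simp⟩
  have hlt : packEntropyAt S ε Z₂ < t := lt_of_le_of_lt
    (le_iSup₂ (f := fun (ε : ℝ≥0) (_ : 0 < ε) => packEntropyAt S ε Z₂) ε hε) ht
  obtain ⟨W, hW, hWN⟩ := exists_cover_of_packMeas_eq_zero S (packMeas_eq_zero_of_lt S hlt)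
  have hT := (bowenMeas_eq_zero_iff T).1 (bowenMeas_eq_zero_of_lt T hs)
  refine bowenPreN_iUnion_eq_zero _ (V := fun i => Z₁ ×ˢ W i) ?_ fun i => ?_
  · rw [← prod_iUnion]
    exact prod_mono Subset.rfl hW
  · obtain ⟨M, hM⟩ := hWN i
    refine le_antisymm ?_ zero_le
    -- The threshold `M` depends on the piece `W i`; raising `N` past it is harmless, since the cost
    -- of `Z₁` vanishes at every order bound.
    calc _ ≤ bowenPreN (Prod.map T S) (s + t) (max N M) (3 * ε) (Z₁ ×ˢ W i) :=
          bowenPreN_mono_left _ (le_max_left _ _) _ _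
      _ ≤ bowenPreN T s (max N M) (3 * ε) Z₁ :=
          bowenPreN_prod_le T S hε ((packPreN_anti_left S t (le_max_right _ _) ε _).trans hM)
      _ = 0 := hT _ hε₀ _

/-- A disjoint family has at most `exp ((s + t) n)` members of order `n`, so the surplus exponent
`u` leaves a geometric tail. -/
theorem packPreN_prod_le {s t u ε : ℝ≥0} {N : ℕ} {V : Set X} {W : Set Y}
    (hV : packPreN T s N ε V ≤ 1) (hW : packPreN S t N ε W ≤ 1) {M : ℕ} (hM : N ≤ M) :
    packPreN (Prod.map T S) (u + (s + t)) M (4 * ε) (V ×ˢ W) ≤ ∑' k, expWeight u (k + M) := by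
  refine iSup_le fun C => iSup_le fun hC => iSup_le fun hN => iSup_le fun hd => ?_
  choose E _ _ hE hEs using fun k : ℕ =>
    exists_spanning_of_packPreN_le_one T hV (hM.trans (Nat.le_add_left M k))
  choose F _ _ hF hFs using fun k : ℕ =>
    exists_spanning_of_packPreN_le_one S hW (hM.trans (Nat.le_add_left M k))
  have hk : ∀ p : C, p.1.2 - M + M = p.1.2 := fun p => Nat.sub_add_cancel (hN _ p.2).2
  choose e he hed using fun p : C => hE (p.1.2 - M) p.1.1.1 (hN _ p.2).1.1
  choose f hf hfd using fun p : C => hF (p.1.2 - M) p.1.1.2 (hN _ p.2).1.2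
  simp only [hk] at hed hfd
  let g : C → Σ k, E k × F k := fun p => ⟨p.1.2 - M, ⟨e p, he p⟩, ⟨f p, hf p⟩⟩
  have hg : Function.Injective g := by
    intro p q hpq
    have hval : ∀ r : C, (g r).1 = r.1.2 - M ∧ ((g r).2.1 : X) = e r ∧ ((g r).2.2 : Y) = f r :=
      fun r => ⟨rfl, rfl, rfl⟩
    have h1 : p.1.2 = q.1.2 := by
      rw [← hk p, ← hk q, ← (hval p).1, ← (hval q).1, hpq]
    have h2 : e p = e q := by rw [← (hval p).2.1, ← (hval q).2.1, hpq]
    have h3 : f p = f q := by rw [← (hval p).2.2, ← (hval q).2.2, hpq]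
    by_contra hne
    have hdis := hd p.2 q.2 fun h => hne (Subtype.ext h)
    -- Members of equal order sharing both spanning points have centers within `2 * ε + 2 * ε`, so
    -- the center of `q` lies in both balls.
    refine Set.disjoint_left.1 hdis (?_ : q.1.1 ∈ _) (by simp [closedBowenBall])
    have h4 : (4 : ℝ≥0) * ε = 2 * ε + 2 * ε := by ring
    change bowenDist _ _ _ _ ≤ _
    rw [bowenDist_prod, h4]
    refine max_le ((bowenDist_triangle T _ _ (e p) _).trans (add_le_add ?_ ?_))
      ((bowenDist_triangle S _ _ (f p) _).trans (add_le_add ?_ ?_))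
    · rw [bowenDist_comm]; exact hed p
    · rw [h1, h2]; exact hed q
    · rw [bowenDist_comm]; exact hfd p
    · rw [h1, h3]; exact hfd q
  calc ∑' p : C, expWeight (u + (s + t)) p.1.2
      = ∑' p : C, expWeight (u + (s + t)) ((g p).1 + M) := by
        exact tsum_congr fun p => by rw [← hk p]
    _ ≤ ∑' q : Σ k, E k × F k, expWeight (u + (s + t)) (q.1 + M) :=
        ENNReal.tsum_comp_le_tsum_of_injective hg fun q => expWeight (u + (s + t)) (q.1 + M)
    _ = ∑' k, expWeight u (k + M) *
          ((∑' _ : E k, expWeight s (k + M)) * ∑' _ : F k, expWeight t (k + M)) := by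
        rw [ENNReal.tsum_sigma']
        refine tsum_congr fun k => ?_
        simp only [expWeight_add, ENNReal.tsum_prod', ENNReal.tsum_mul_left]
        congr 1
        rw [← ENNReal.tsum_mul_left, ← ENNReal.tsum_mul_right]
    _ ≤ ∑' k, expWeight u (k + M) :=
        ENNReal.tsum_le_tsum fun k => mul_le_of_le_one_right' (mul_le_one' (hEs k) (hFs k))

theorem packPre_prod_eq_zero {s t u ε : ℝ≥0} (hu : 0 < u) {V : Set X} {W : Set Y}
    (hV : ∃ N, packPreN T s N ε V ≤ 1) (hW : ∃ N, packPreN S t N ε W ≤ 1) :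
    packPre (Prod.map T S) (u + (s + t)) (4 * ε) (V ×ˢ W) = 0 := by
  obtain ⟨N₁, h₁⟩ := hV
  obtain ⟨N₂, h₂⟩ := hW
  refine le_antisymm (ge_of_tendsto
    (ENNReal.tendsto_sum_nat_add _ (tsum_expWeight_ne_top hu)) ?_) zero_le
  filter_upwards [eventually_ge_atTop (max N₁ N₂)] with M hM
  exact iInf_le_of_le M (packPreN_prod_le T S
    ((packPreN_anti_left T s (le_max_left _ _) ε V).trans h₁)
    ((packPreN_anti_left S t (le_max_right _ _) ε W).trans h₂) hM)

theorem packEntropyAt_prod_le (ε : ℝ≥0) (Z₁ : Set X) (Z₂ : Set Y) :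
    packEntropyAt (Prod.map T S) (4 * ε) (Z₁ ×ˢ Z₂)
      ≤ packEntropyAt T ε Z₁ + packEntropyAt S ε Z₂ := by
  refine le_of_forall_gt fun r hr => ?_
  obtain ⟨s, hs, t, ht, hst⟩ := ENNReal.exists_add_lt_of_add_lt hr
  lift s to ℝ≥0 using ne_top_of_le_ne_top hst.ne_top le_self_add
  lift t to ℝ≥0 using ne_top_of_le_ne_top hst.ne_top le_add_self
  -- The gap `v - (s + t)` serves as the surplus exponent.
  obtain ⟨v, hv, hvr⟩ := ENNReal.lt_iff_exists_nnreal_btwn.1 hst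
  have hv : s + t < v := by exact_mod_cast hv
  refine lt_of_le_of_lt (iInf₂_le v ?_) hvr
  obtain ⟨V, hV, hVN⟩ := exists_cover_of_packMeas_eq_zero T (packMeas_eq_zero_of_lt T hs)
  obtain ⟨W, hW, hWN⟩ := exists_cover_of_packMeas_eq_zero S (packMeas_eq_zero_of_lt S ht)
  refine le_antisymm (iInf₂_le_of_le
    (fun k => V (Nat.unpair k).1 ×ˢ W (Nat.unpair k).2) ?_ ?_) zero_le
  · rintro ⟨z, w⟩ ⟨hz, hw⟩
    obtain ⟨i, hi⟩ := mem_iUnion.1 (hV hz)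
    obtain ⟨j, hj⟩ := mem_iUnion.1 (hW hw)
    exact mem_iUnion.2 ⟨Nat.pair i j, by simpa using ⟨hi, hj⟩⟩
  · refine (ENNReal.tsum_eq_zero.2 fun k => ?_).le
    have := packPre_prod_eq_zero T S (tsub_pos_of_lt hv) (hVN (Nat.unpair k).1)
      (hWN (Nat.unpair k).2)
    rwa [tsub_add_cancel_of_le hv.le] at this

theorem packEntropy_prod_le (Z₁ : Set X) (Z₂ : Set Y) :
    packEntropy (Prod.map T S) (Z₁ ×ˢ Z₂) ≤ packEntropy T Z₁ + packEntropy S Z₂ := by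
  refine iSup₂_le fun ε₀ hε₀ => ?_
  obtain ⟨ε, hε, rfl⟩ : ∃ ε : ℝ≥0, 0 < ε ∧ ε₀ = 4 * ε :=
    ⟨ε₀ / 4, by positivity, by field_simp⟩
  exact (packEntropyAt_prod_le T S ε Z₁ Z₂).trans (add_le_add
    (le_iSup₂ (f := fun (ε : ℝ≥0) (_ : 0 < ε) => packEntropyAt T ε Z₁) ε hε)
    (le_iSup₂ (f := fun (ε : ℝ≥0) (_ : 0 < ε) => packEntropyAt S ε Z₂) ε hε))

end Upper

/-! ### Separated sets and upper capacity entropy. -/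

section Capacity

variable {X Y : Type*} [MetricSpace X] [MetricSpace Y] (T : X → X) (S : Y → Y)

theorem exists_spanning_encard_le_sepCard (n : ℕ) (ε : ℝ≥0) (Z : Set X) :
    ∃ E : Set X, E.encard ≤ sepCard T n ε Z ∧ ∀ y ∈ Z, ∃ x ∈ E, bowenDist T n x y ≤ ε := by
  obtain ⟨E, hEZ, hEr, hmax⟩ := exists_maximal_pairwise
    (r := fun x y => ε < bowenDist T n x y) (fun x y h => by rwa [bowenDist_comm]) Z
  refine ⟨E, le_iSup₂ (f := fun (E : Set X) (_ : IsSep T n ε Z E) => E.encard) E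
    ⟨hEZ, fun x hx y hy hxy => hEr hx hy hxy⟩, fun y hy => ?_⟩
  by_cases hyE : y ∈ E
  · exact ⟨y, hyE, by simp⟩
  · obtain ⟨x, hx, hxy⟩ := hmax y hy hyE
    exact ⟨x, hx, not_lt.1 hxy⟩

theorem sepCard_prod_le (n : ℕ) (ε : ℝ≥0) (Z₁ : Set X) (Z₂ : Set Y) :
    sepCard (Prod.map T S) n (2 * ε) (Z₁ ×ˢ Z₂) ≤ sepCard T n ε Z₁ * sepCard S n ε Z₂ := by
  obtain ⟨E, hEc, hE⟩ := exists_spanning_encard_le_sepCard T n ε Z₁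
  obtain ⟨F, hFc, hF⟩ := exists_spanning_encard_le_sepCard S n ε Z₂
  refine iSup₂_le fun A hA => ?_
  refine le_trans ?_ (mul_le_mul' hEc hFc)
  rw [← encard_prod]
  choose e he hed using fun p : A => hE p.1.1 (hA.1 p.2).1
  choose f hf hfd using fun p : A => hF p.1.2 (hA.1 p.2).2
  have hinj : Function.Injective
      fun p : A => (⟨(e p, f p), he p, hf p⟩ : (E ×ˢ F : Set (X × Y))) := by
    intro p q hpq
    obtain ⟨h1, h2⟩ := Prod.ext_iff.1 (congrArg Subtype.val hpq)
    change e p = e q at h1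
    change f p = f q at h2
    by_contra hne
    refine absurd (hA.2 _ p.2 _ q.2 fun h => hne (Subtype.ext h)) (not_lt.2 ?_)
    rw [bowenDist_prod, two_mul]
    refine max_le ((bowenDist_triangle T _ _ (e p) _).trans (add_le_add ?_ ?_))
      ((bowenDist_triangle S _ _ (f p) _).trans (add_le_add ?_ ?_))
    · rw [bowenDist_comm]; exact hed p
    · rw [h1]; exact hed q
    · rw [bowenDist_comm]; exact hfd p
    · rw [h2]; exact hfd q
  exact ENat.card_le_card_of_injective hinj

theorem one_le_sepCard {n : ℕ} {ε : ℝ≥0} {Z : Set X} (hZ : Z.Nonempty) :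
    1 ≤ sepCard T n ε Z := by
  obtain ⟨z, hz⟩ := hZ
  refine le_trans (by simp) (le_iSup₂ (f := fun (E : Set X) (_ : IsSep T n ε Z E) => E.encard)
    {z} ⟨singleton_subset_iff.2 hz, ?_⟩)
  rintro x rfl y rfl h
  exact absurd rfl h

/-- The exponential growth rate of the cardinality of separated sets at scale `ε`. -/
noncomputable def sepRate (ε : ℝ≥0) (Z : Set X) : EReal :=
  limsup (fun n : ℕ => ENNReal.log ((sepCard T n ε Z : ℕ∞) : ℝ≥0∞) / (n : EReal)) atTop

theorem log_sepCard_nonneg {n : ℕ} {ε : ℝ≥0} {Z : Set X} (hZ : Z.Nonempty) :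
    0 ≤ ENNReal.log ((sepCard T n ε Z : ℕ∞) : ℝ≥0∞) := by
  rw [← ENNReal.log_one]
  exact ENNReal.log_monotone (by exact_mod_cast one_le_sepCard T hZ)

theorem sepRate_nonneg {ε : ℝ≥0} {Z : Set X} (hZ : Z.Nonempty) : 0 ≤ sepRate T ε Z :=
  le_limsup_of_frequently_le (Frequently.of_forall fun n =>
    EReal.div_nonneg (log_sepCard_nonneg T hZ) (by positivity))

theorem sepRate_prod_le (ε : ℝ≥0) {Z₁ : Set X} {Z₂ : Set Y} (h₁ : Z₁.Nonempty)
    (h₂ : Z₂.Nonempty) :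
    sepRate (Prod.map T S) (2 * ε) (Z₁ ×ˢ Z₂) ≤ sepRate T ε Z₁ + sepRate S ε Z₂ := by
  -- Excludes `⊥ + ⊤`, for which subadditivity of `limsup` in `EReal` could fail.
  have hb₁ := (EReal.bot_lt_zero.trans_le (sepRate_nonneg T (ε := ε) h₁)).ne'
  have hb₂ := (EReal.bot_lt_zero.trans_le (sepRate_nonneg S (ε := ε) h₂)).ne'
  refine le_trans (limsup_le_limsup (Eventually.of_forall fun n => ?_))
    (EReal.limsup_add_le (.inl hb₁) (.inr hb₂))
  have h := sepCard_prod_le T S n ε Z₁ Z₂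
  simp only [Pi.add_apply]
  rw [← EReal.div_right_distrib_of_nonneg (log_sepCard_nonneg T h₁) (log_sepCard_nonneg S h₂),
    ← ENNReal.log_mul_add, ← ENat.toENNReal_mul]
  exact EReal.div_le_div_right_of_nonneg (by positivity)
    (ENNReal.log_monotone (ENat.toENNReal_mono h))

theorem sepCard_empty (n : ℕ) (ε : ℝ≥0) : sepCard T n ε ∅ = 0 := by
  simp only [sepCard, ENat.iSup_eq_zero, encard_eq_zero]
  exact fun E hE => subset_empty_iff.1 hE.1

theorem upperCapEntropy_empty : upperCapEntropy T ∅ = ⊥ := by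
  simp only [upperCapEntropy, iSup_eq_bot]
  intro ε _
  have : (fun n : ℕ => ENNReal.log ((sepCard T n ε ∅ : ℕ∞) : ℝ≥0∞) / (n : EReal))
      =ᶠ[atTop] fun _ => ⊥ := by
    -- At `n = 0` the quotient is `0` rather than `⊥`.
    filter_upwards [eventually_gt_atTop 0] with n hn
    rw [sepCard_empty]
    simp only [ENat.toENNReal_zero, ENNReal.log_zero]
    exact EReal.bot_div_of_pos_ne_top (by exact_mod_cast hn) (EReal.natCast_ne_top n)
  rw [limsup_congr this, limsup_const]

theorem upperCapEntropy_prod_le (Z₁ : Set X) (Z₂ : Set Y) :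
    upperCapEntropy (Prod.map T S) (Z₁ ×ˢ Z₂) ≤ upperCapEntropy T Z₁ + upperCapEntropy S Z₂ := by
  rcases Z₁.eq_empty_or_nonempty with rfl | h₁
  · rw [empty_prod, upperCapEntropy_empty]
    exact bot_le
  rcases Z₂.eq_empty_or_nonempty with rfl | h₂
  · rw [prod_empty, upperCapEntropy_empty]
    exact bot_le
  refine iSup₂_le fun ε₀ hε₀ => ?_
  obtain ⟨ε, hε, rfl⟩ : ∃ ε : ℝ≥0, 0 < ε ∧ ε₀ = 2 * ε :=
    ⟨ε₀ / 2, by positivity, by field_simp⟩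
  exact (sepRate_prod_le T S ε h₁ h₂).trans (add_le_add
    (le_iSup₂ (f := fun (ε : ℝ≥0) (_ : 0 < ε) => sepRate T ε Z₁) ε hε)
    (le_iSup₂ (f := fun (ε : ℝ≥0) (_ : 0 < ε) => sepRate S ε Z₂) ε hε))

end Capacity

end ProductEntropy

theorem mainTheorem1 {X Y : Type*} [MetricSpace X] [CompactSpace X] [MetricSpace Y]
    [CompactSpace Y] (T : X → X) (hT : Continuous T) (S : Y → Y) (hS : Continuous S) :
    (ProductEntropy.bowenEntropy T Set.univ < ⊤ → ProductEntropy.bowenEntropy S Set.univ < ⊤ →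
      ∀ (Z₁ : Set X) (Z₂ : Set Y), MeasureTheory.AnalyticSet Z₁ → Z₁.Nonempty →
        MeasureTheory.AnalyticSet Z₂ → Z₂.Nonempty →
        ProductEntropy.bowenEntropy T Z₁ + ProductEntropy.bowenEntropy S Z₂
          ≤ ProductEntropy.bowenEntropy (Prod.map T S) (Z₁ ×ˢ Z₂)) ∧
    (∀ (Z₁ : Set X) (Z₂ : Set Y),
      ProductEntropy.bowenEntropy (Prod.map T S) (Z₁ ×ˢ Z₂)
        ≤ ProductEntropy.bowenEntropy T Z₁ + ProductEntropy.packEntropy S Z₂) ∧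
    (∀ (Z₁ : Set X) (Z₂ : Set Y),
      ProductEntropy.packEntropy (Prod.map T S) (Z₁ ×ˢ Z₂)
        ≤ ProductEntropy.packEntropy T Z₁ + ProductEntropy.packEntropy S Z₂) ∧
    (∀ (Z₁ : Set X) (Z₂ : Set Y),
      ProductEntropy.upperCapEntropy (Prod.map T S) (Z₁ ×ˢ Z₂)
        ≤ ProductEntropy.upperCapEntropy T Z₁ + ProductEntropy.upperCapEntropy S Z₂) :=
  ⟨fun _ _ _ _ _ h₁ _ h₂ => ProductEntropy.bowenEntropy_add_le_prod T S h₁ h₂,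
    ProductEntropy.bowenEntropy_prod_le T S, ProductEntropy.packEntropy_prod_le T S,
    ProductEntropy.upperCapEntropy_prod_le T S⟩
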